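/- Let $M$ be a smooth ($C^\infty$) manifold without boundary of dimension $n$ (for example the manifold underlying a complete Riemannian manifold; no metric is needed), and let $N\ge 1$ be an integer. Let $T^NM$ be the smooth fiber bundle over $M$ whose fiber over $p\in M$ is $(T_pM)^N$; its points are the tuples $V=(v_1,\dots,v_N)$ of tangent vectors of $M$ at a common base point $\pi'(V)\in M$. Let $$\tilde F: T^NM\to TM,\qquad \tilde F(v_1,\dots,v_N)=\sum_{i=1}^N v_i ,$$ let $Z\subset TM$ be the zero section, and let $$\tilde Z=\Big\{(v_1,\dots,v_N)\in T^NM:\ \sum_{i=1}^N v_i=0\Big\}=\tilde F^{-1}(Z)$$ be the set of pre-barycenters. A submersion is a smooth map whose differential is surjective at every point, and a submanifold is a smoothly embedded one. Then: (a) The map $\tilde F$ is a submersion, and $\tilde Z$ is a submanifold of $T^NM$ of dimension $Nn$. (b) The restricted base-point projection $\pi'|_{\tilde Z}:\tilde Z\to M$ is a submersion, and it maps $\tilde Z$ onto $M$. -/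

import Mathlib

open scoped Manifold ContDiff

noncomputable section

/-- The componentwise action `T ↦ ((v₁, …, v_N) ↦ (T v₁, …, T v_N))`, as a continuous linear map
in `T`. -/
def diagPiMap (E : Type*) [NormedAddCommGroup E] [NormedSpace ℝ E] (N : ℕ) :
    (E →L[ℝ] E) →L[ℝ] ((Fin N → E) →L[ℝ] (Fin N → E)) :=
  LinearMap.mkContinuous
    { toFun := fun T => ContinuousLinearMap.piMap fun _ : Fin N => T
      map_add' := fun _ _ => rfl
      map_smul' := fun _ _ => rfl } 1 (fun T => by
    rw [one_mul]
    refine ContinuousLinearMap.opNorm_le_bound _ (norm_nonneg T) fun v => ?_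
    refine (pi_norm_le_iff_of_nonneg (by positivity)).2 fun k => ?_
    exact (T.le_opNorm (v k)).trans
      (mul_le_mul_of_nonneg_left (norm_le_pi_norm v k) (norm_nonneg T)))

/-- The transition data of the bundle `T^N M → M`: over each chart of `M` it is trivial with fiber
`E^N`, and the transition maps are those of the tangent bundle acting on each of the `N` components
separately. -/
def tangentPowCore {E H : Type*} [NormedAddCommGroup E] [NormedSpace ℝ E] [TopologicalSpace H]
    (I : ModelWithCorners ℝ E H) (M : Type*) [TopologicalSpace M] [ChartedSpace H M]
    [IsManifold I 1 M] (N : ℕ) : VectorBundleCore ℝ M (Fin N → E) (atlas H M) where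
  baseSet := (tangentBundleCore I M).baseSet
  isOpen_baseSet := (tangentBundleCore I M).isOpen_baseSet
  indexAt := (tangentBundleCore I M).indexAt
  mem_baseSet_at := (tangentBundleCore I M).mem_baseSet_at
  coordChange i j x := diagPiMap E N ((tangentBundleCore I M).coordChange i j x)
  coordChange_self i x hx v :=
    funext fun k => (tangentBundleCore I M).coordChange_self i x hx (v k)
  continuousOn_coordChange i j :=
    (diagPiMap E N).continuous.comp_continuousOn
      ((tangentBundleCore I M).continuousOn_coordChange i j)
  coordChange_comp i j k x hx v :=
    funext fun l => (tangentBundleCore I M).coordChange_comp i j k x hx (v l)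

section Bundle

variable {E H : Type*} [NormedAddCommGroup E] [NormedSpace ℝ E] [TopologicalSpace H]
  (I : ModelWithCorners ℝ E H) {M : Type*} [TopologicalSpace M] [ChartedSpace H M]

/-- The fiber `(T_p M)^N` of `T^N M` over `p`. -/
def TangentPowSpace (N : ℕ) (p : M) : Type _ := Fin N → TangentSpace I p

instance (N : ℕ) (p : M) : TopologicalSpace (TangentPowSpace I N p) :=
  inferInstanceAs (TopologicalSpace (Fin N → TangentSpace I p))

instance (N : ℕ) (p : M) : AddCommGroup (TangentPowSpace I N p) :=
  inferInstanceAs (AddCommGroup (Fin N → TangentSpace I p))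

instance (N : ℕ) (p : M) : Module ℝ (TangentPowSpace I N p) :=
  inferInstanceAs (Module ℝ (Fin N → TangentSpace I p))

variable (M)

/-- The total space `T^N M`, whose points are the tuples `V = (v₁, …, v_N)` of tangent vectors at a
common base point `V.proj`, with `V.snd k : T_{V.proj} M` the component number `k`. -/
abbrev TangentPow (N : ℕ) : Type _ :=
  Bundle.TotalSpace (Fin N → E) (TangentPowSpace I N : M → Type _)

variable [IsManifold I 1 M]

instance (N : ℕ) : TopologicalSpace (TangentPow I M N) :=
  inferInstanceAs (TopologicalSpace (tangentPowCore I M N).TotalSpace)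

instance (N : ℕ) : FiberBundle (Fin N → E) (TangentPowSpace I N : M → Type _) :=
  inferInstanceAs (FiberBundle (Fin N → E) (tangentPowCore I M N).Fiber)

instance (N : ℕ) : VectorBundle ℝ (Fin N → E) (TangentPowSpace I N : M → Type _) :=
  inferInstanceAs (VectorBundle ℝ (Fin N → E) (tangentPowCore I M N).Fiber)

/-- For a smooth manifold `M`, `T^N M` is a smooth vector bundle; in particular it is a smooth
manifold. -/
instance (N : ℕ) [hM : IsManifold I ∞ M] :
    ContMDiffVectorBundle ∞ (Fin N → E) (TangentPowSpace I N : M → Type _) I := by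
  have : IsManifold I (∞ + 1) M := hM
  have h : (tangentBundleCore I M).IsContMDiff I ∞ := tangentBundleCore.isContMDiff
  have h' : (tangentPowCore I M N).IsContMDiff I ∞ :=
    ⟨fun i j => (diagPiMap E N).contMDiff.comp_contMDiffOn (h.contMDiffOn_coordChange i j)⟩
  exact (tangentPowCore I M N).instContMDiffVectorBundle

/-- In the bundle charts, `T^N M` is the `N`-fold fiberwise product of the tangent bundle: each
component of `V` is read in the corresponding chart of the tangent bundle. -/
theorem tangentPow_trivializationAt_apply (N : ℕ) (p : M) (V : TangentPow I M N) :
    trivializationAt (Fin N → E) (TangentPowSpace I N : M → Type _) p V =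
      (V.proj, fun k =>
        (trivializationAt E (TangentSpace I : M → Type _) p ⟨V.proj, V.snd k⟩).2) :=
  rfl

variable {M} {N : ℕ}

/-- The fiberwise sum `T^N M → TM`, `(v₁, …, v_N) ↦ v₁ + ⋯ + v_N`. -/
def tangentSum (V : TangentPow I M N) : TangentBundle I M :=
  ⟨V.proj, ∑ k : Fin N, (V.snd k : TangentSpace I V.proj)⟩

variable (M N)

/-- The set of pre-barycenters: the tuples `(v₁, …, v_N)` with `v₁ + ⋯ + v_N = 0`. -/
def preBarycenters : Set (TangentPow I M N) :=
  {V | ∑ k : Fin N, (V.snd k : TangentSpace I V.proj) = 0}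

/-- The zero section of `TM`, as a subset of `TM`. -/
def tangentZeroSection : Set (TangentBundle I M) :=
  Set.range fun p : M => (⟨p, 0⟩ : TangentBundle I M)

end Bundle

section Submersion

variable {E H E' H' : Type*} [NormedAddCommGroup E] [NormedSpace ℝ E] [TopologicalSpace H]
  [NormedAddCommGroup E'] [NormedSpace ℝ E'] [TopologicalSpace H']
  (I : ModelWithCorners ℝ E H) (J : ModelWithCorners ℝ E' H')
  {X Y : Type*} [TopologicalSpace X] [ChartedSpace H X] [TopologicalSpace Y] [ChartedSpace H' Y]

/-- A smooth submersion (between finite-dimensional manifolds): around every point `f` is the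
projection `(u, w) ↦ u` in suitable charts (which includes smoothness), and the differential of `f`
at every point is onto. For finite-dimensional manifolds without boundary, the first condition
is equivalent to smoothness together with the second one. -/
structure IsSmoothSubmersion (f : X → Y) : Prop where
  isSubmersion : Manifold.IsSubmersion I J ∞ f
  surjective_mfderiv : ∀ x, Function.Surjective (mfderiv I J f x)

/-- The charts `c` make the subset `S` of the manifold `X` a `d`-dimensional (embedded) smooth
submanifold: with the subspace topology and these charts `S` is a smooth `d`-dimensional manifold
whose inclusion into `X` is a smooth embedding. -/
structure IsSubmanifoldStructure (S : Set X) (d : ℕ)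
    (c : ChartedSpace (EuclideanSpace ℝ (Fin d)) S) : Prop where
  isManifold : IsManifold (𝓡 d) ∞ S
  isSmoothEmbedding : Manifold.IsSmoothEmbedding (𝓡 d) I ∞ (Subtype.val : S → X)

end Submersion

end

/-! Trivializations of `TM` are linear on fibers, so in bundle charts the sum map reads `(x, v₀, …,
v_m) ↦ (x, ∑ v_k)`. As `N = m + 1 ≥ 1`, the vector `v₀` can be traded linearly for the sum
(`sumTailEquiv`). In the new coordinates the sum map is a projection with complement `E^m`, and the
pre-barycenters form the slice where the sum coordinate vanishes. The free coordinates on this slice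
are `(x, v₁, …, v_m)`, and the base-point projection forgets all but `x`. Slice charts thus give the
submanifold structure. By `restrChart_mem_maximalAtlas` they are compatible with any other such
structure, so the projection is a submersion for each of them. Zero tuples give surjectivity. -/

/-! ### Local sections and surjectivity of the differential -/

section SubmersionDifferential

open Topology

variable {E H E' H' F : Type*} [NormedAddCommGroup E] [NormedSpace ℝ E] [TopologicalSpace H]
  [NormedAddCommGroup E'] [NormedSpace ℝ E'] [TopologicalSpace H']
  [NormedAddCommGroup F] [NormedSpace ℝ F]
  {I : ModelWithCorners ℝ E H} {J : ModelWithCorners ℝ E' H'}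
  {X Y : Type*} [TopologicalSpace X] [ChartedSpace H X] [TopologicalSpace Y] [ChartedSpace H' Y]

/-- A submersion at a point of a manifold without boundary has a smooth local section through this
point, so its differential there is onto. -/
theorem Manifold.IsSubmersionAtOfComplement.surjective_mfderiv [I.Boundaryless]
    [IsManifold I ∞ X] [IsManifold J ∞ Y] {f : X → Y} {x : X}
    (h : Manifold.IsSubmersionAtOfComplement F I J ∞ f x) :
    Function.Surjective (mfderiv I J f x) := by
  set φ := h.domChart
  set ψ := h.codChart
  have hx : x ∈ φ.source := h.mem_domChart_source
  have hfx : f x ∈ ψ.source := h.mem_codChart_source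
  have hψ : ContMDiffAt J 𝓘(ℝ, E') ∞ (ψ.extend J) (f x) :=
    ((J.contMDiff (n := ∞)).contMDiffAt.comp _
      (contMDiffAt_of_mem_maximalAtlas h.codChart_mem_maximalAtlas hfx))
  have hφt : φ.extend I x ∈ (φ.extend I).target :=
    (φ.extend I).map_source (by rwa [φ.extend_source])
  -- The complementary coordinate is frozen at its value at `x`, so that the section `g` passes
  -- through `x`.
  let a : E' → E := fun u => h.equiv.symm (u, (h.equiv (φ.extend I x)).2)
  have ha : ContDiff ℝ ∞ a := by fun_prop
  have ha0 : a (ψ.extend J (f x)) = φ.extend I x := by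
    have := h.writtenInCharts hφt
    simp only [Function.comp_apply] at this
    rw [φ.extend_left_inv hx] at this
    simp only [a]
    rw [this]
    simp
  let g : Y → X := (φ.extend I).symm ∘ a ∘ ψ.extend J
  have hgx : g (f x) = x := by
    simp only [g, Function.comp_apply, ha0]
    exact φ.extend_left_inv hx
  have hsym : ContMDiffAt 𝓘(ℝ, E) I ∞ (φ.extend I).symm (a (ψ.extend J (f x))) := by
    have h1 := contMDiffOn_extend_symm h.domChart_mem_maximalAtlas
    rw [ha0]
    refine h1.contMDiffAt ?_
    -- `h1` gives smoothness on `I '' φ.target`; this is the target of `φ.extend I`, open because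
    -- there is no boundary.
    have := φ.isOpen_extend_target (I := I) |>.mem_nhds hφt
    rwa [φ.extend_target_eq_image_source, ← φ.image_source_eq_target, Set.image_image] at *
  have hg : ContMDiffAt J I ∞ g (f x) := by
    refine ContMDiffAt.comp (f x) hsym ?_
    exact ContMDiffAt.comp (f x) ha.contMDiff.contMDiffAt hψ
  have hfg : f ∘ g =ᶠ[𝓝 (f x)] id := by
    have e1 : ∀ᶠ y in 𝓝 (f x), y ∈ ψ.source := ψ.open_source.mem_nhds hfx
    have hc : ContinuousAt (a ∘ ψ.extend J) (f x) :=
      ha.continuous.continuousAt.comp hψ.continuousAt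
    have e2 : ∀ᶠ y in 𝓝 (f x), (a ∘ ψ.extend J) y ∈ (φ.extend I).target :=
      hc.eventually_mem (by
        rw [Function.comp_apply, ha0]; exact φ.isOpen_extend_target.mem_nhds hφt)
    filter_upwards [e1, e2] with y hy1 hy2
    have h3 := h.writtenInCharts hy2
    have h4 : g y ∈ φ.source := by
      have := (φ.extend I).map_target hy2
      rwa [φ.extend_source] at this
    have h5 : f (g y) ∈ ψ.source := h.source_subset_preimage_source h4
    have h6 : ψ.extend J (f (g y)) = ψ.extend J y := by
      simp only [Function.comp_apply, a, ContinuousLinearEquiv.apply_symm_apply] at h3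
      simpa only [g, Function.comp_apply, a] using h3
    exact (ψ.extend J).injOn (by rwa [ψ.extend_source]) (by rwa [ψ.extend_source]) h6
  have hf : MDifferentiableAt I J f (g (f x)) := by
    rw [hgx]; exact h.contMDiffAt.mdifferentiableAt (by simp)
  -- By the chain rule the differential of `g` is a right inverse of that of `f`.
  have hd := mfderiv_comp (f x) hf (hg.mdifferentiableAt (by simp))
  rw [hfg.mfderiv_eq, mfderiv_id] at hd
  rw [hgx] at hd
  intro w
  exact ⟨mfderiv J I g (f x) w, (DFunLike.congr_fun hd w).symm⟩

theorem Manifold.IsSubmersionOfComplement.isSmoothSubmersion [I.Boundaryless]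
    [IsManifold I ∞ X] [IsManifold J ∞ Y] {f : X → Y}
    (h : Manifold.IsSubmersionOfComplement F I J ∞ f) : IsSmoothSubmersion I J f :=
  ⟨h.isSubmersion, fun x => (h x).surjective_mfderiv⟩

end SubmersionDifferential

/-! ### Submanifolds from slice charts -/

section SliceCharts

open Topology

variable {E H B F : Type*} [NormedAddCommGroup E] [NormedSpace ℝ E] [TopologicalSpace H]
  [NormedAddCommGroup B] [NormedSpace ℝ B] [NormedAddCommGroup F] [NormedSpace ℝ F]
  {I : ModelWithCorners ℝ E H} {X : Type*} [TopologicalSpace X] [ChartedSpace H X]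

/-- The chart `ψ` of `X` flattens `S`: in this chart, and up to the linear equivalence
`L : B × F ≃ E`, the set `S` is the slice `B × {0}`. -/
structure IsSliceChart (I : ModelWithCorners ℝ E H) (L : (B × F) ≃L[ℝ] E) (S : Set X)
    (ψ : OpenPartialHomeomorph X H) : Prop where
  mem_maximalAtlas : ψ ∈ IsManifold.maximalAtlas I ∞ X
  mem_iff : ∀ x ∈ ψ.source, x ∈ S ↔ (L.symm (ψ.extend I x)).2 = 0

namespace IsSliceChart

variable {L : (B × F) ≃L[ℝ] E} {S : Set X} {ψ ψ' : OpenPartialHomeomorph X H}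

theorem apply_fst_zero (h : IsSliceChart I L S ψ) {x : X} (hx : x ∈ ψ.source) (hS : x ∈ S) :
    L ((L.symm (ψ.extend I x)).1, 0) = ψ.extend I x := by
  rw [← (h.mem_iff x hx).1 hS, Prod.mk.eta, L.apply_symm_apply]

theorem symm_mem_source (_ : IsSliceChart I L S ψ) {u : B} (hu : L (u, 0) ∈ (ψ.extend I).target) :
    (ψ.extend I).symm (L (u, 0)) ∈ ψ.source := by
  simpa only [ψ.extend_source] using (ψ.extend I).map_target hu

theorem symm_mem (h : IsSliceChart I L S ψ) {u : B} (hu : L (u, 0) ∈ (ψ.extend I).target) :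
    (ψ.extend I).symm (L (u, 0)) ∈ S := by
  rw [h.mem_iff _ (h.symm_mem_source hu), (ψ.extend I).right_inv hu]
  simp

theorem contMDiffAt_coord (h : IsSliceChart I L S ψ) {x : X} (hx : x ∈ ψ.source) :
    ContMDiffAt I 𝓘(ℝ, B) ∞ (fun x => (L.symm (ψ.extend I x)).1) x := by
  have hL : ContDiff ℝ ∞ fun y : E => (L.symm y).1 := by fun_prop
  exact hL.contMDiff.contMDiffAt.comp x ((I.contMDiff (n := ∞)).contMDiffAt.comp x
    (contMDiffAt_of_mem_maximalAtlas h.mem_maximalAtlas hx))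

theorem contMDiffAt_symm [I.Boundaryless] (h : IsSliceChart I L S ψ) {u : B}
    (hu : L (u, 0) ∈ (ψ.extend I).target) :
    ContMDiffAt 𝓘(ℝ, B) I ∞ (fun u => (ψ.extend I).symm (L (u, 0))) u := by
  have hL : ContDiff ℝ ∞ fun u : B => L (u, 0) := by fun_prop
  have h1 := contMDiffOn_extend_symm h.mem_maximalAtlas
  refine ContMDiffAt.comp u (h1.contMDiffAt ?_) hL.contMDiff.contMDiffAt
  have := ψ.isOpen_extend_target (I := I) |>.mem_nhds hu
  rwa [ψ.extend_target_eq_image_source, ← ψ.image_source_eq_target, Set.image_image] at *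

open Classical in
/-- The chart of the subspace `S` given by a slice chart of `X`. The point `x₀` of `S` is only used
as a default value outside of the target. -/
noncomputable def restrChart [I.Boundaryless] (h : IsSliceChart I L S ψ) (x₀ : S) :
    OpenPartialHomeomorph S B where
  toFun x := (L.symm (ψ.extend I x)).1
  invFun u := if hu : L (u, 0) ∈ (ψ.extend I).target then ⟨_, h.symm_mem hu⟩ else x₀
  source := Subtype.val ⁻¹' ψ.source
  target := {u | L (u, 0) ∈ (ψ.extend I).target}
  map_source' x hx := by
    rw [Set.mem_ofPred_eq, h.apply_fst_zero hx x.2]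
    exact (ψ.extend I).map_source (by rwa [ψ.extend_source])
  map_target' u hu := by
    rw [Set.mem_ofPred_eq] at hu
    simpa only [hu, dite_true, Set.mem_preimage] using h.symm_mem_source hu
  left_inv' x hx := by
    have := h.apply_fst_zero hx x.2
    have ht : ψ.extend I x ∈ (ψ.extend I).target :=
      (ψ.extend I).map_source (by rwa [ψ.extend_source])
    ext
    simp only [this, ht, dite_true]
    exact ψ.extend_left_inv hx
  right_inv' u hu := by
    rw [Set.mem_ofPred_eq] at hu
    simp only [hu, dite_true, (ψ.extend I).right_inv hu, L.symm_apply_apply]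
  open_source := ψ.open_source.preimage continuous_subtype_val
  open_target := ψ.isOpen_extend_target.preimage (by fun_prop)
  continuousOn_toFun x hx := ((h.contMDiffAt_coord hx).continuousAt.comp
    continuous_subtype_val.continuousAt).continuousWithinAt
  continuousOn_invFun := by
    rw [Topology.IsInducing.subtypeVal.continuousOn_iff]
    refine ContinuousOn.congr (f := fun u => (ψ.extend I).symm (L (u, 0))) ?_ fun u hu => by
      rw [Set.mem_ofPred_eq] at hu
      simp only [Function.comp_apply, hu, dite_true]
    exact fun u hu => (h.contMDiffAt_symm hu).continuousAt.continuousWithinAt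

variable [I.Boundaryless]

theorem restrChart_apply (h : IsSliceChart I L S ψ) (x₀ x : S) :
    h.restrChart x₀ x = (L.symm (ψ.extend I x)).1 := rfl

@[simp]
theorem mem_restrChart_source (h : IsSliceChart I L S ψ) {x₀ x : S} :
    x ∈ (h.restrChart x₀).source ↔ x.1 ∈ ψ.source := Iff.rfl

@[simp]
theorem mem_restrChart_target (h : IsSliceChart I L S ψ) {x₀ : S} {u : B} :
    u ∈ (h.restrChart x₀).target ↔ L (u, 0) ∈ (ψ.extend I).target := Iff.rfl

theorem restrChart_symm_val (h : IsSliceChart I L S ψ) {x₀ : S} {u : B}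
    (hu : u ∈ (h.restrChart x₀).target) :
    ((h.restrChart x₀).symm u).1 = (ψ.extend I).symm (L (u, 0)) := by
  classical
  change (if hu : L (u, 0) ∈ (ψ.extend I).target then (⟨_, h.symm_mem hu⟩ : S) else x₀).1 = _
  rw [dif_pos (h.mem_restrChart_target.1 hu)]

theorem contMDiffAt_val_comp_restrChart_symm (h : IsSliceChart I L S ψ) {x₀ : S} {u : B}
    (hu : u ∈ (h.restrChart x₀).target) :
    ContMDiffAt 𝓘(ℝ, B) I ∞ (Subtype.val ∘ (h.restrChart x₀).symm) u :=
  (h.contMDiffAt_symm hu).congr_of_eventuallyEq <|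
    Filter.eventually_of_mem ((h.restrChart x₀).open_target.mem_nhds hu)
      fun _ hv => h.restrChart_symm_val hv

/-- The transition map factors through `X`: a smooth parametrization of the slice, followed by a
coordinate function that is smooth on an open subset of `X`. -/
theorem contDiffOn_restrChart_symm_trans (h : IsSliceChart I L S ψ) (h' : IsSliceChart I L S ψ')
    (x₀ x₁ : S) :
    ContDiffOn ℝ ∞ ((h.restrChart x₀).symm.trans (h'.restrChart x₁))
      ((h.restrChart x₀).symm.trans (h'.restrChart x₁)).source := by
  intro u hu
  rw [OpenPartialHomeomorph.trans_source] at hu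
  have h1 := h.contMDiffAt_val_comp_restrChart_symm (x₀ := x₀) (u := u) hu.1
  have h2 : ContMDiffAt I 𝓘(ℝ, B) ∞ (fun x => (L.symm (ψ'.extend I x)).1)
      ((Subtype.val ∘ (h.restrChart x₀).symm) u) := h'.contMDiffAt_coord hu.2
  exact (contMDiffAt_iff_contDiffAt.1 (h2.comp u h1)).contDiffWithinAt

/-- The charts of `S` obtained from slice charts belong to every structure on `S` whose inclusion
is a smooth immersion. -/
theorem restrChart_mem_maximalAtlas [ChartedSpace B S] [IsManifold 𝓘(ℝ, B) ∞ S]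
    (hS : Manifold.IsImmersion 𝓘(ℝ, B) I ∞ (Subtype.val : S → X)) (h : IsSliceChart I L S ψ)
    (x₀ : S) : h.restrChart x₀ ∈ IsManifold.maximalAtlas 𝓘(ℝ, B) ∞ S := by
  refine (h.restrChart x₀).mem_maximalAtlas_of_contMDiffOn ?_ ?_
  · intro x hx
    have h1 : ContMDiffAt 𝓘(ℝ, B) I ∞ (Subtype.val : S → X) x := hS.contMDiff.contMDiffAt
    have h2 : ContMDiffAt I 𝓘(ℝ, B) ∞ (fun y => (L.symm (ψ.extend I y)).1) (x : X) :=
      h.contMDiffAt_coord hx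
    exact (h2.comp x h1).contMDiffWithinAt
  · intro u hu
    refine ContMDiffAt.contMDiffWithinAt ?_
    -- A continuous map into `S` is smooth as soon as its composite with the immersion is.
    rw [ContMDiffAt.iff_comp_isImmersionAt (hS.isImmersionAt _)]
    exact ⟨(h.restrChart x₀).symm.continuousAt hu, h.contMDiffAt_val_comp_restrChart_symm hu⟩

end IsSliceChart

/-- A subset flattened by slice charts around each of its points is a submanifold. -/
theorem exists_isSubmanifoldStructure_of_isSliceChart [I.Boundaryless] {d : ℕ} {S : Set X}
    {L : (EuclideanSpace ℝ (Fin d) × F) ≃L[ℝ] E}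
    (hS : ∀ x ∈ S, ∃ ψ : OpenPartialHomeomorph X H, IsSliceChart I L S ψ ∧ x ∈ ψ.source) :
    ∃ c : ChartedSpace (EuclideanSpace ℝ (Fin d)) S, IsSubmanifoldStructure I S d c := by
  choose ψ hψ hxψ using fun x : S => hS x.1 x.2
  let c : ChartedSpace (EuclideanSpace ℝ (Fin d)) S :=
    { atlas := Set.range fun x => (hψ x).restrChart x
      chartAt := fun x => (hψ x).restrChart x
      mem_chart_source := hxψ
      chart_mem_atlas := fun x => ⟨x, rfl⟩ }
  have hM : IsManifold (𝓡 d) ∞ S := by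
    refine isManifold_of_contDiffOn _ _ _ ?_
    rintro _ _ ⟨x, rfl⟩ ⟨y, rfl⟩
    simpa using (hψ x).contDiffOn_restrChart_symm_trans (hψ y) x y
  refine ⟨c, hM, ?_, Topology.IsEmbedding.subtypeVal⟩
  -- In a slice chart the inclusion reads `u ↦ L (u, 0)`.
  refine Manifold.IsImmersionOfComplement.isImmersion (F := F) fun x => ?_
  refine Manifold.IsImmersionAtOfComplement.mk_of_charts L ((hψ x).restrChart x) (ψ x) (hxψ x)
    (hxψ x) (IsManifold.chart_mem_maximalAtlas x) (hψ x).mem_maximalAtlas (fun _ h => h) ?_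
  intro u hu
  have hu' : u ∈ ((hψ x).restrChart x).target := by simpa using hu
  simp only [Function.comp_apply, OpenPartialHomeomorph.extend_coe_symm,
    modelWithCornersSelf_coe_symm, id_eq, (hψ x).restrChart_symm_val hu']
  exact ((ψ x).extend I).right_inv hu'

end SliceCharts

/-- The linear change of coordinates `v ↦ (v₀ + ⋯ + v_m, (v₁, …, v_m))`. -/
noncomputable def sumTailEquiv (E : Type*) [NormedAddCommGroup E] [NormedSpace ℝ E] (m : ℕ) :
    (Fin (m + 1) → E) ≃L[ℝ] E × (Fin m → E) where
  toFun v := (∑ k, v k, fun k => v k.succ)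
  invFun w := Fin.cons (w.1 - ∑ k, w.2 k) w.2
  map_add' v w := by simp only [Pi.add_apply, Finset.sum_add_distrib]; rfl
  map_smul' a v := by simp only [Pi.smul_apply, ← Finset.smul_sum]; rfl
  left_inv v := by
    ext k
    refine Fin.cases ?_ (fun _ => ?_) k <;> simp [Fin.sum_univ_succ]
  right_inv w := by simp [Fin.sum_univ_succ]
  continuous_toFun := by fun_prop
  continuous_invFun := continuous_pi fun k => by
    refine Fin.cases ?_ (fun _ => ?_) k <;> simp only [Fin.cons_zero, Fin.cons_succ] <;> fun_prop

/-! ### The sum map and the pre-barycenters in bundle charts -/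

section TangentPow

variable {E H : Type*} [NormedAddCommGroup E] [NormedSpace ℝ E] [TopologicalSpace H]
  (I : ModelWithCorners ℝ E H) {M : Type*} [TopologicalSpace M] [ChartedSpace H M]
  [IsManifold I 1 M]

theorem mem_chartAt_tangentPow_source {N : ℕ} {V₀ V : TangentPow I M N} :
    V ∈ (chartAt (ModelProd H (Fin N → E)) V₀).source ↔ V.proj ∈ (chartAt H V₀.proj).source := by
  rw [FiberBundle.chartedSpace_chartAt]
  exact ⟨fun h => h.2.1, fun h => ⟨(Bundle.Trivialization.mem_source _).2 h, h, Set.mem_univ _⟩⟩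

theorem extend_chartAt_tangentPow_apply {N : ℕ} (V₀ V : TangentPow I M N) :
    (chartAt (ModelProd H (Fin N → E)) V₀).extend (I.prod 𝓘(ℝ, Fin N → E)) V =
      ((chartAt H V₀.proj).extend I V.proj, fun k =>
        (trivializationAt E (TangentSpace I : M → Type _) V₀.proj ⟨V.proj, V.snd k⟩).2) :=
  rfl

theorem trivializationAt_tangentSum {N : ℕ} {p : M} {V : TangentPow I M N}
    (hV : V.proj ∈ (chartAt H p).source) :
    (trivializationAt E (TangentSpace I : M → Type _) p (tangentSum I V)).2 =
      ∑ k, (trivializationAt E (TangentSpace I : M → Type _) p ⟨V.proj, V.snd k⟩).2 := by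
  have hlin := (trivializationAt E (TangentSpace I : M → Type _) p).linear ℝ (b := V.proj) hV
  exact map_sum hlin.mk' (fun k => V.snd k) Finset.univ

theorem extend_chartAt_tangentSum_apply {N : ℕ} {V₀ V : TangentPow I M N}
    (hV : V.proj ∈ (chartAt H V₀.proj).source) :
    (chartAt (ModelProd H E) (tangentSum I V₀)).extend I.tangent (tangentSum I V) =
      ((chartAt H V₀.proj).extend I V.proj,
        ∑ k, (trivializationAt E (TangentSpace I : M → Type _) V₀.proj ⟨V.proj, V.snd k⟩).2) := by
  rw [← trivializationAt_tangentSum I hV]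
  rfl

theorem mem_preBarycenters_iff_of_mem_source {N : ℕ} {p : M} {V : TangentPow I M N}
    (hV : V.proj ∈ (chartAt H p).source) :
    V ∈ preBarycenters I M N ↔
      ∑ k, (trivializationAt E (TangentSpace I : M → Type _) p ⟨V.proj, V.snd k⟩).2 = 0 := by
  rw [← trivializationAt_tangentSum I hV]
  exact ((trivializationAt E (TangentSpace I : M → Type _) p).continuousLinearEquivAt ℝ
    V.proj hV).map_eq_zero_iff.symm

omit [IsManifold I 1 M] in
theorem preBarycenters_eq_preimage (N : ℕ) :
    preBarycenters I M N = tangentSum I ⁻¹' tangentZeroSection I M := by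
  ext ⟨p, v⟩
  constructor
  · intro h
    exact ⟨p, congrArg (Bundle.TotalSpace.mk p) (Eq.symm h)⟩
  · rintro ⟨q, hq⟩
    obtain rfl : q = p := congrArg Bundle.TotalSpace.proj hq
    exact (Bundle.TotalSpace.mk_inj.1 hq).symm

omit [IsManifold I 1 M] in
theorem surjective_proj_preBarycenters (N : ℕ) :
    Function.Surjective fun V : preBarycenters I M N => V.val.proj :=
  fun p => ⟨⟨⟨p, fun _ => (0 : TangentSpace I p)⟩, Finset.sum_const_zero⟩, rfl⟩

theorem isSubmersionOfComplement_tangentSum [IsManifold I ∞ M] (m : ℕ) :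
    Manifold.IsSubmersionOfComplement (Fin m → E) (I.prod 𝓘(ℝ, Fin (m + 1) → E)) I.tangent ∞
      (tangentSum I : TangentPow I M (m + 1) → TangentBundle I M) := by
  have : IsManifold I (∞ + 1) M := ‹IsManifold I ∞ M›
  intro V₀
  refine Manifold.IsSubmersionAtOfComplement.mk_of_charts
    (((ContinuousLinearEquiv.refl ℝ E).prodCongr (sumTailEquiv E m)).trans
      (ContinuousLinearEquiv.prodAssoc ℝ E E (Fin m → E)).symm)
    (chartAt (ModelProd H (Fin (m + 1) → E)) V₀) (chartAt (ModelProd H E) (tangentSum I V₀))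
    (mem_chart_source _ V₀) (mem_chart_source _ (tangentSum I V₀))
    (IsManifold.chart_mem_maximalAtlas V₀) (IsManifold.chart_mem_maximalAtlas (tangentSum I V₀))
    ?_ ?_
  · intro V hV
    exact (TangentBundle.mem_chart_source_iff (tangentSum I V) (tangentSum I V₀)).2
      ((mem_chartAt_tangentPow_source I).1 hV)
  · intro y hy
    set φ := (chartAt (ModelProd H (Fin (m + 1) → E)) V₀).extend (I.prod 𝓘(ℝ, Fin (m + 1) → E))
      with hφ
    have hV : φ.symm y ∈ (chartAt (ModelProd H (Fin (m + 1) → E)) V₀).source := by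
      simpa only [hφ, OpenPartialHomeomorph.extend_source] using φ.map_target hy
    have hy' := φ.right_inv hy
    rw [hφ, extend_chartAt_tangentPow_apply, ← hφ] at hy'
    simp only [Function.comp_apply]
    rw [extend_chartAt_tangentSum_apply I ((mem_chartAt_tangentPow_source I).1 hV)]
    -- `hy'` says that `y` is the chart reading of `φ.symm y`; summing its vector components gives
    -- the claim.
    exact congrArg (fun z : E × (Fin (m + 1) → E) => (z.1, ∑ k, z.2 k)) hy'

/-- The coordinates of `T^N M` in which the last component is the sum of the vectors. -/
noncomputable def preBarycentersCoord {B : Type*} [NormedAddCommGroup B] [NormedSpace ℝ B] {m : ℕ}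
    (ℓ : B ≃L[ℝ] E × (Fin m → E)) : (B × E) ≃L[ℝ] E × (Fin (m + 1) → E) :=
  ((ℓ.prodCongr (ContinuousLinearEquiv.refl ℝ E)).trans
    (ContinuousLinearEquiv.prodAssoc ℝ E (Fin m → E) E)).trans
    ((ContinuousLinearEquiv.refl ℝ E).prodCongr
      ((ContinuousLinearEquiv.prodComm ℝ (Fin m → E) E).trans (sumTailEquiv E m).symm))

/-- The inverse coordinates send `(x, v)` to `(ℓ⁻¹ (x, v₁, …, v_m), ∑ v_k)`, so `ℓ` recovers the
base coordinate `x`. -/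
theorem preBarycentersCoord_symm_apply_fst {B : Type*} [NormedAddCommGroup B] [NormedSpace ℝ B]
    {m : ℕ} (ℓ : B ≃L[ℝ] E × (Fin m → E)) (z : E × (Fin (m + 1) → E)) :
    (ℓ ((preBarycentersCoord ℓ).symm z).1).1 = z.1 :=
  congrArg Prod.fst (ℓ.apply_symm_apply (z.1, fun k => z.2 k.succ))

theorem isSliceChart_chartAt [IsManifold I ∞ M]
    {B : Type*} [NormedAddCommGroup B] [NormedSpace ℝ B] {m : ℕ}
    (ℓ : B ≃L[ℝ] E × (Fin m → E)) (V₀ : TangentPow I M (m + 1)) :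
    IsSliceChart (I.prod 𝓘(ℝ, Fin (m + 1) → E)) (preBarycentersCoord ℓ)
      (preBarycenters I M (m + 1)) (chartAt (ModelProd H (Fin (m + 1) → E)) V₀) where
  mem_maximalAtlas := IsManifold.chart_mem_maximalAtlas V₀
  mem_iff _ hV :=
    mem_preBarycenters_iff_of_mem_source I ((mem_chartAt_tangentPow_source I).1 hV)

theorem isSubmersionOfComplement_proj_preBarycenters [I.Boundaryless] [IsManifold I ∞ M]
    {B : Type*} [NormedAddCommGroup B] [NormedSpace ℝ B] {m : ℕ} (ℓ : B ≃L[ℝ] E × (Fin m → E))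
    [ChartedSpace B (preBarycenters I M (m + 1))]
    [IsManifold 𝓘(ℝ, B) ∞ (preBarycenters I M (m + 1))]
    (hi : Manifold.IsImmersion 𝓘(ℝ, B) (I.prod 𝓘(ℝ, Fin (m + 1) → E)) ∞
      (Subtype.val : preBarycenters I M (m + 1) → TangentPow I M (m + 1))) :
    Manifold.IsSubmersionOfComplement (Fin m → E) 𝓘(ℝ, B) I ∞
      (fun V : preBarycenters I M (m + 1) => V.val.proj) := by
  intro V₀
  have hs := isSliceChart_chartAt I ℓ V₀.1
  refine Manifold.IsSubmersionAtOfComplement.mk_of_charts ℓ (hs.restrChart V₀)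
    (chartAt H V₀.1.proj) (hs.mem_restrChart_source.2 (mem_chart_source _ V₀.1))
    (mem_chart_source _ V₀.1.proj)
    (hs.restrChart_mem_maximalAtlas hi V₀) (IsManifold.chart_mem_maximalAtlas V₀.1.proj)
    (fun V hV => (mem_chartAt_tangentPow_source I).1 hV) ?_
  intro u hu
  have hu' : u ∈ (hs.restrChart V₀).target := by simpa using hu
  have h := congrArg ℓ ((hs.restrChart V₀).right_inv hu')
  rw [hs.restrChart_apply] at h
  have h2 := congrArg Prod.fst h
  rw [preBarycentersCoord_symm_apply_fst, extend_chartAt_tangentPow_apply] at h2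
  exact h2

end TangentPow

theorem proposition3p1 (n N : ℕ) (hN : 0 < N) (M : Type*) [TopologicalSpace M]
    [ChartedSpace (EuclideanSpace ℝ (Fin n)) M] [IsManifold (𝓡 n) ∞ M] :
    -- the fiberwise sum is a submersion
    IsSmoothSubmersion ((𝓡 n).prod 𝓘(ℝ, Fin N → EuclideanSpace ℝ (Fin n))) (𝓡 n).tangent
      (tangentSum (𝓡 n) : TangentPow (𝓡 n) M N → TangentBundle (𝓡 n) M) ∧
    -- the set of pre-barycenters is the preimage of the zero section
    preBarycenters (𝓡 n) M N = tangentSum (𝓡 n) ⁻¹' tangentZeroSection (𝓡 n) M ∧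
    -- it is a submanifold of dimension `N * n`
    (∃ c : ChartedSpace (EuclideanSpace ℝ (Fin (N * n))) (preBarycenters (𝓡 n) M N),
      IsSubmanifoldStructure ((𝓡 n).prod 𝓘(ℝ, Fin N → EuclideanSpace ℝ (Fin n)))
        (preBarycenters (𝓡 n) M N) (N * n) c) ∧
    -- for its structure of a submanifold, the base-point projection to `M` is a submersion
    (∀ c : ChartedSpace (EuclideanSpace ℝ (Fin (N * n))) (preBarycenters (𝓡 n) M N),
      IsSubmanifoldStructure ((𝓡 n).prod 𝓘(ℝ, Fin N → EuclideanSpace ℝ (Fin n)))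
        (preBarycenters (𝓡 n) M N) (N * n) c →
      IsSmoothSubmersion (𝓡 (N * n)) (𝓡 n)
        (fun V : preBarycenters (𝓡 n) M N => V.val.proj)) ∧
    -- and it is onto
    Function.Surjective (fun V : preBarycenters (𝓡 n) M N => V.val.proj) := by
  obtain ⟨m, rfl⟩ := Nat.exists_eq_succ_of_ne_zero hN.ne'
  have : IsManifold (𝓡 n) (∞ + 1) M := ‹IsManifold (𝓡 n) ∞ M›
  -- Any linear equivalence serves here; only the count `(m + 1) * n = n + m * n` matters.
  let ℓ : EuclideanSpace ℝ (Fin ((m + 1) * n)) ≃L[ℝ]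
      EuclideanSpace ℝ (Fin n) × (Fin m → EuclideanSpace ℝ (Fin n)) :=
    ContinuousLinearEquiv.ofFinrankEq (by
      rw [Module.finrank_prod, Module.finrank_pi_fintype]
      simp [add_mul, add_comm])
  refine ⟨(isSubmersionOfComplement_tangentSum (𝓡 n) m).isSmoothSubmersion,
    preBarycenters_eq_preimage (𝓡 n) _, ?_, fun c hc => ?_, surjective_proj_preBarycenters (𝓡 n) _⟩
  · exact exists_isSubmanifoldStructure_of_isSliceChart fun V _ =>
      ⟨_, isSliceChart_chartAt (𝓡 n) ℓ V, mem_chart_source _ V⟩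
  · have := hc.isManifold
    exact (isSubmersionOfComplement_proj_preBarycenters (𝓡 n) ℓ
      hc.isSmoothEmbedding.isImmersion).isSmoothSubmersion
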